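/- Let $K$ be a field of characteristic zero, let $P_n=K[x_1,\dots,x_n]$, let $I=(f_1,\dots,f_m)$ be a prime ideal of $P_n$, and let $\mathcal A=S^{-1}(P_n/I)$ be a localization of $P_n/I$ at a multiplicative set $S$. Assume that $\mathcal A$ is a regular domain, and let $\{\cdot,\cdot\}$ be a Poisson bracket on $\mathcal A$, i.e. a $K$-bilinear Lie bracket with $\{a,xy\}=\{a,x\}y+x\{a,y\}$ for all $a,x,y\in\mathcal A$. Let $\mathrm{Der}_K(\mathcal A)$ be the $\mathcal A$-module of $K$-derivations of $\mathcal A$, and let $\mathcal A\mathcal H_{\mathcal A}$ be its $\mathcal A$-submodule generated by all the derivations $\{a,\cdot\}$, $a\in\mathcal A$. Let $Q$ be the field of fractions of $\mathcal A$. Let $r$ be the rank over $Q$ of the Jacobian matrix $\left(\frac{\partial f_i}{\partial x_j}\right)\in M_{m,n}(\mathcal A)$, and let $d$ be the rank over $Q$ of the matrix $\mathcal C_{\mathcal A}=(\{x_i,x_j\})\in M_n(\mathcal A)$. For $\mathbf i=(i_1<\dots<i_r)$ in $\{1,\dots,m\}$ and $\mathbf j=(j_1<\dots<j_r)$ in $\{1,\dots,n\}$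 let $\Delta(\mathbf i,\mathbf j)=\det\left(\frac{\partial f_{i_\nu}}{\partial x_{j_\mu}}\right)_{\nu,\mu=1,\dots,r}\in\mathcal A$. Let $\mathbb I_r$ be the set of those $\mathbf i$ with $\Delta(\mathbf i,\mathbf j')\neq0$ for some $\mathbf j'$, and let $\mathbb J_r$ be the set of those $\mathbf j$ with $\Delta(\mathbf i',\mathbf j)\neq0$ for some $\mathbf i'$. For $s\ge0$ let $\mathfrak c_{\mathcal A,s}$ be the ideal of $\mathcal A$ generated by all the $s\times s$ minors of $\mathcal C_{\mathcal A}$. For $\mathbf j\in\mathbb J_r$ let $\mathfrak m_{\mathbf j}$ be the ideal of $\mathcal A$ generated by all the $(n-r)\times(n-r)$ minors of the $n\times(n-r)$ matrix $\mathcal C_{\mathcal A,\mathbf j}$ obtained from $\mathcal C_{\mathcal A}$ by deleting the columns with indices $j_1,\dots,j_r$. (A $0\times0$ minor is $1$.) Then the following statements are equivalent: 1. $\mathrm{Der}_K(\mathcal A)=\mathcal A\mathcal H_{\mathcal A}$. 2. $d=n-r$ and $\mathfrak c_{\mathcal A,d}=\mathcal A$. 3. For all $\mathbf i\in\mathbb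 I_r$ and $\mathbf j\in\mathbb J_r$, $\Delta(\mathbf i,\mathbf j)^{n-r}\in\mathfrak m_{\mathbf j}$. 4. For all $\mathbf i\in\mathbb I_r$ and $\mathbf j\in\mathbb J_r$, $\Delta(\mathbf i,\mathbf j)^{k}\in\mathfrak c_{\mathcal A,n-r}$ for some $k\ge1$. -/

import Mathlib

/-- A Poisson structure on a commutative `K`-algebra `A`: a `K`-bilinear Lie bracket on `A`
that is a derivation of the (associative) multiplication. -/
structure PoissonBracket (K A : Type*) [CommRing K] [CommRing A] [Algebra K A] where
  /-- the bracket `{a, b}` -/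
  bracket : A →ₗ[K] A →ₗ[K] A
  bracket_self : ∀ a, bracket a a = 0
  jacobi : ∀ a b c,
    bracket a (bracket b c) + bracket b (bracket c a) + bracket c (bracket a b) = 0
  leibniz : ∀ a x y, bracket a (x * y) = bracket a x * y + x * bracket a y

namespace PoissonBracket

variable {K A : Type*} [CommRing K] [CommRing A] [Algebra K A]

/-- The Hamiltonian vector field `{a, ·}` of `a`, as a `K`-derivation of `A`. -/
def pad (π : PoissonBracket K A) (a : A) : Derivation K A A :=
  Derivation.mk' (π.bracket a) (fun x y => by
    rw [π.leibniz, smul_eq_mul, smul_eq_mul, mul_comm (π.bracket a x) y, add_comm])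

/-- The `A`-submodule `A · H_A` of `Der_K(A)` generated by all Hamiltonian vector fields. -/
def hamiltonianSpan (π : PoissonBracket K A) : Submodule A (Derivation K A A) :=
  Submodule.span A (Set.range π.pad)

end PoissonBracket

/-- The ideal generated by all the `s × s` minors of a matrix, i.e. by the determinants of the
submatrices given by increasing `s`-tuples of row and of column indices. -/
def minorsIdeal {A ι κ : Type*} [CommRing A] [LinearOrder ι] [LinearOrder κ]
    (M : Matrix ι κ A) (s : ℕ) : Ideal A :=
  Ideal.span {a | ∃ (i : Fin s ↪o ι) (j : Fin s ↪o κ), a = (M.submatrix i j).det}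

/-- The rank over the field of fractions `Q(A)` of a matrix with entries in the domain `A`. -/
noncomputable def fracRank {A ι κ : Type*} [CommRing A] [Fintype κ] (M : Matrix ι κ A) : ℕ :=
  (M.map (algebraMap A (FractionRing A))).rank

/-! In this section `A` is an algebra over `K[x_1, …, x_n]/(f_1, …, f_m)`
(in the theorem: a localization of it). -/
section Presentation

variable {K : Type*} [Field K] {n m : ℕ} (f : Fin m → MvPolynomial (Fin n) K)
variable (A : Type*) [CommRing A] [Algebra (MvPolynomial (Fin n) K ⧸ Ideal.span (Set.range f)) A]

/-- The canonical homomorphism from `K[x_1, …, x_n]` to `A`. -/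
noncomputable def presHom : MvPolynomial (Fin n) K →+* A :=
  (algebraMap (MvPolynomial (Fin n) K ⧸ Ideal.span (Set.range f)) A).comp
    (Ideal.Quotient.mk (Ideal.span (Set.range f)))

/-- The Jacobian matrix `(∂f_i/∂x_j)`, with entries in `A`. -/
noncomputable def jacobianMatrix : Matrix (Fin m) (Fin n) A :=
  Matrix.of fun i j => presHom f A (MvPolynomial.pderiv j (f i))

/-- The rank `r` of the Jacobian matrix over the field of fractions of `A`. -/
noncomputable def jacobianRank : ℕ := fracRank (jacobianMatrix f A)

/-- The minor `Δ(i, j)` of the Jacobian matrix, for increasing `s`-tuples `i` of row indices and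
`j` of column indices. -/
noncomputable def jacobianMinor {s : ℕ} (i : Fin s ↪o Fin m) (j : Fin s ↪o Fin n) : A :=
  ((jacobianMatrix f A).submatrix i j).det

/-- The set of non-singular `r`-tuples of row indices. -/
def nonsingularRows : Set (Fin (jacobianRank f A) ↪o Fin m) :=
  {i | ∃ j : Fin (jacobianRank f A) ↪o Fin n, jacobianMinor f A i j ≠ 0}

/-- The set of non-singular `r`-tuples of column indices. -/
def nonsingularCols : Set (Fin (jacobianRank f A) ↪o Fin n) :=
  {j | ∃ i : Fin (jacobianRank f A) ↪o Fin m, jacobianMinor f A i j ≠ 0}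

variable {A} [Algebra K A]

/-- The `n × n` matrix `C_A = ({x_i, x_j})`. -/
noncomputable def poissonMatrix (π : PoissonBracket K A) : Matrix (Fin n) (Fin n) A :=
  Matrix.of fun i j =>
    π.bracket (presHom f A (MvPolynomial.X i)) (presHom f A (MvPolynomial.X j))

/-- The matrix `C_{A, j}` obtained from `C_A` by deleting the columns with indices in the
tuple `j`. -/
noncomputable def poissonMatrixDel (π : PoissonBracket K A) {s : ℕ} (j : Fin s ↪o Fin n) :
    Matrix (Fin n) {l : Fin n // l ∉ Set.range j} A :=
  (poissonMatrix f π).submatrix id Subtype.val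

end Presentation

/-! ### Ranks, minors and kernels of matrices -/

section MatrixLemmas

open Matrix Module

/-! A derivation `D` of `A` is the same as a vector `(D x_j)` in the kernel of the Jacobian matrix
`J` on `A^n`. The Hamiltonian derivations are spanned by the rows of `C = ({x_i, x_j})`, so `C Jᵀ =
0` and `d ≤ n - r`.

1 → 3: Cramer's rule gives derivations whose values on the `n - r` variables outside `j` form the
matrix `Δ(i, j) · 1`. Writing them as combinations of the rows of `C` and taking determinants by
Cauchy–Binet puts `Δ(i, j)^(n-r)` in `m_j`. 3 → 4 holds because minors of a submatrix are minors of
`C`. 4 → 2: by the Jacobian criterion (`exists_jacobianMinor_notMem`) no maximal ideal contains all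
the `Δ(i, j)`, hence none contains the ideal of `(n-r)`-minors of `C`. 2 → 1: if `d = n - r`, the
rows of a nonzero `d`-minor span the kernel of `J` over `Q`, so by Cramer each `d`-minor multiplies
every derivation into the Hamiltonian span; these minors generate `A`.

The Jacobian criterion is a dimension count at a prime `p` with residue field `κ`. The kernel of `J`
over `κ` consists of derivations `A_p → κ`, a space of dimension at most `dim A_p + trdeg κ` by
regularity and characteristic zero. Lifting a chain of primes bounds this by `trdeg Q ≤ n - r`, so
`J` keeps rank at least `r` modulo `p`. -/

theorem exists_orderEmb_linearIndependent_rows {F ι κ : Type*} [Field F] [Fintype ι] [Fintype κ]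
    [LinearOrder ι] (M : Matrix ι κ F) {s : ℕ} (hs : s ≤ M.rank) :
    ∃ i : Fin s ↪o ι, LinearIndependent F (M.submatrix i id).row := by
  obtain ⟨τ, a, ha, hspan, hli⟩ := exists_linearIndependent' F M.row
  have : Finite τ := Finite.of_injective a ha
  cases nonempty_fintype τ
  have hcard : M.rank = Fintype.card τ := by
    rw [M.rank_eq_finrank_span_row, ← hspan, finrank_span_eq_card hli]
  obtain ⟨t, hts, ht⟩ := Finset.exists_subset_card_eq (s := Finset.univ.map ⟨a, ha⟩) (n := s)
    (by simpa [hcard] using hs)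
  have h : ∀ k, ∃ b, a b = t.orderEmbOfFin ht k := fun k => by
    simpa using hts (t.orderEmbOfFin_mem ht k)
  choose g hg using h
  refine ⟨t.orderEmbOfFin ht, ?_⟩
  have hginj : Function.Injective g := fun x y hxy => by
    have := congrArg a hxy
    rw [hg, hg] at this
    exact (t.orderEmbOfFin ht).injective this
  have h : (M.submatrix (t.orderEmbOfFin ht) id).row = (M.row ∘ a) ∘ g := by
    ext k l
    simp only [Matrix.row, submatrix_apply, id_eq, Function.comp_apply, ← hg]
    rfl
  rw [h]
  exact hli.comp g hginj

theorem exists_det_submatrix_ne_zero {F ι κ : Type*} [Field F] [Fintype ι] [Fintype κ]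
    [LinearOrder ι] [LinearOrder κ] (M : Matrix ι κ F) {s : ℕ} (hs : s ≤ M.rank) :
    ∃ (i : Fin s ↪o ι) (j : Fin s ↪o κ), (M.submatrix i j).det ≠ 0 := by
  obtain ⟨i, hi⟩ := exists_orderEmb_linearIndependent_rows M hs
  have hr : s ≤ (M.submatrix i id)ᵀ.rank := by
    rw [rank_transpose, hi.rank_matrix, Fintype.card_fin]
  obtain ⟨j, hj⟩ := exists_orderEmb_linearIndependent_rows _ hr
  refine ⟨i, j, ?_⟩
  rw [← det_transpose]
  exact ((Matrix.isUnit_iff_isUnit_det _).mp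
    (Matrix.linearIndependent_rows_iff_isUnit.mp hj)).ne_zero

theorem le_rank_of_det_submatrix_ne_zero {F ι κ : Type*} [Field F] [Fintype ι] [Fintype κ]
    (M : Matrix ι κ F) {s : ℕ} (i : Fin s → ι) (j : Fin s → κ)
    (h : (M.submatrix i j).det ≠ 0) : s ≤ M.rank := by
  have := M.rank_submatrix_le i j
  rwa [rank_of_det_ne_zero h, Fintype.card_fin] at this

/-- A repeated index makes the determinant zero; otherwise sorting both tuples changes it only by
signs. -/
theorem det_submatrix_mem_minorsIdeal {A ι κ : Type*} [CommRing A] [LinearOrder ι]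
    [LinearOrder κ] (M : Matrix ι κ A) {s : ℕ} (i : Fin s → ι) (j : Fin s → κ) :
    (M.submatrix i j).det ∈ minorsIdeal M s := by
  by_cases hi : Function.Injective i
  swap
  · simp only [Function.Injective, not_forall] at hi
    obtain ⟨a, b, hab, hne⟩ := hi
    rw [det_zero_of_row_eq hne (by ext; simp [hab])]
    exact zero_mem _
  by_cases hj : Function.Injective j
  swap
  · simp only [Function.Injective, not_forall] at hj
    obtain ⟨a, b, hab, hne⟩ := hj
    rw [det_zero_of_column_eq hne (by intro; simp [hab])]
    exact zero_mem _
  let i' : Fin s ↪o ι := OrderEmbedding.ofStrictMono (i ∘ Tuple.sort i)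
    ((Tuple.monotone_sort i).strictMono_of_injective (hi.comp (Equiv.injective _)))
  let j' : Fin s ↪o κ := OrderEmbedding.ofStrictMono (j ∘ Tuple.sort j)
    ((Tuple.monotone_sort j).strictMono_of_injective (hj.comp (Equiv.injective _)))
  have h : M.submatrix i j =
      ((M.submatrix i' j').submatrix (Tuple.sort i).symm id).submatrix id (Tuple.sort j).symm := by
    ext a b
    simp [i', j']
  rw [h, det_permute', det_permute]
  exact Ideal.mul_mem_left _ _ (Ideal.mul_mem_left _ _ (Ideal.subset_span ⟨i', j', rfl⟩))

/-- The half of Cauchy–Binet that is needed: each row of the product is a combination of rows of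
`M`, and the determinant is expanded multilinearly in the rows. -/
theorem det_mul_mem_minorsIdeal {A ι κ : Type*} [CommRing A] [Fintype ι] [LinearOrder ι]
    [LinearOrder κ] (M : Matrix ι κ A) {s : ℕ} (B : Matrix (Fin s) ι A) (j : Fin s → κ) :
    (B * M.submatrix id j).det ∈ minorsIdeal M s := by
  have h : B * M.submatrix id j = fun k => ∑ l, B k l • (M.submatrix id j) l := by
    ext k c
    simp [Matrix.mul_apply, Finset.sum_apply]
  have h2 : (B * M.submatrix id j).det =
      ∑ φ : Fin s → ι, (∏ k, B k (φ k)) • (M.submatrix φ j).det := by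
    rw [h]
    change detRowAlternating.toMultilinearMap _ = _
    rw [MultilinearMap.map_sum]
    refine Finset.sum_congr rfl fun φ _ => ?_
    rw [MultilinearMap.map_smul_univ]
    rfl
  rw [h2]
  exact sum_mem fun φ _ => Ideal.mul_mem_left _ _ (det_submatrix_mem_minorsIdeal M φ j)

theorem minorsIdeal_submatrix_le {A ι κ κ' : Type*} [CommRing A] [LinearOrder ι]
    [LinearOrder κ] [LinearOrder κ'] (M : Matrix ι κ A) (g : κ' → κ) (s : ℕ) :
    minorsIdeal (M.submatrix id g) s ≤ minorsIdeal M s := by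
  refine Ideal.span_le.mpr ?_
  rintro _ ⟨i, j, rfl⟩
  exact det_submatrix_mem_minorsIdeal M i (g ∘ j)

theorem finrank_ker_mulVecLin {F ι κ : Type*} [Field F] [Fintype κ] (M : Matrix ι κ F) :
    finrank F (LinearMap.ker M.mulVecLin) + M.rank = Fintype.card κ := by
  have := LinearMap.finrank_range_add_finrank_ker M.mulVecLin
  rw [Module.finrank_fintype_fun_eq_card] at this
  rw [Matrix.rank, add_comm, this]

theorem mulVec_eq_zero_of_submatrix_mulVec_eq_zero {F ι ι' κ : Type*} [Field F] [Fintype κ]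
    (M : Matrix ι κ F) (i : ι' → ι) (h : M.rank ≤ (M.submatrix i id).rank) {v : κ → F}
    (hv : M.submatrix i id *ᵥ v = 0) : M *ᵥ v = 0 := by
  have hle : LinearMap.ker M.mulVecLin ≤ LinearMap.ker (M.submatrix i id).mulVecLin := by
    intro w hw
    rw [LinearMap.mem_ker, mulVecLin_apply] at hw ⊢
    ext a
    exact congrFun hw (i a)
  have h1 := finrank_ker_mulVecLin M
  have h2 := finrank_ker_mulVecLin (M.submatrix i id)
  have heq := Submodule.eq_of_le_of_finrank_le hle (by omega)
  have : v ∈ LinearMap.ker (M.submatrix i id).mulVecLin := hv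
  rwa [← heq] at this

/-- The rows `i` of `C` are independent and lie in `ker J`, so by dimension they span it. Then `u`
is a combination of them, and the nonzero minor forces its coefficients to vanish. -/
theorem eq_zero_of_mem_ker_of_comp_eq_zero {F ι κ μ : Type*} [Field F] [Fintype κ]
    (C : Matrix ι κ F) (J : Matrix μ κ F) (hCJ : C * Jᵀ = 0) {s : ℕ}
    (hs : s + J.rank = Fintype.card κ) (i : Fin s → ι) (j : Fin s → κ)
    (hdet : (C.submatrix i j).det ≠ 0) {u : κ → F} (hu : J *ᵥ u = 0) (huj : u ∘ j = 0) :
    u = 0 := by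
  have hli : LinearIndependent F (C.submatrix i id).row := by
    have h : LinearIndependent F (C.submatrix i j).row :=
      Matrix.linearIndependent_rows_iff_isUnit.mpr
        ((Matrix.isUnit_iff_isUnit_det _).mpr (isUnit_iff_ne_zero.mpr hdet))
    exact LinearIndependent.of_comp (LinearMap.funLeft F F j) h
  have hle : Submodule.span F (Set.range (C.submatrix i id).row) ≤
      LinearMap.ker J.mulVecLin := by
    rw [Submodule.span_le]
    rintro _ ⟨a, rfl⟩
    ext b
    have := congrFun (congrFun hCJ (i a)) b
    rw [Matrix.mul_apply] at this
    simpa [Matrix.mulVec, dotProduct, mul_comm] using this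
  have heq := Submodule.eq_of_le_of_finrank_le hle (by
    rw [finrank_span_eq_card hli, Fintype.card_fin]
    have := finrank_ker_mulVecLin J
    omega)
  have hmem : u ∈ LinearMap.ker J.mulVecLin := hu
  rw [← heq, Submodule.mem_span_range_iff_exists_fun] at hmem
  obtain ⟨c, hc⟩ := hmem
  have hcz : c ᵥ* C.submatrix i j = 0 := by
    ext b
    have := congrFun huj b
    rw [← hc] at this
    simpa [Matrix.vecMul, dotProduct, Finset.sum_apply] using this
  have : c = 0 := Matrix.eq_zero_of_vecMul_eq_zero hdet hcz
  rw [← hc, this]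
  simp

end MatrixLemmas

/-! ### Derivations of a localized quotient of a polynomial ring -/

section DerivationLemmas

open Matrix Module

namespace Derivation

theorem eq_zero_of_algebraMap_eq_zero {K R C M : Type*} [CommRing K] [CommRing R] [CommRing C]
    [Algebra K C] [Algebra R C] (S : Submonoid R) [IsLocalization S C] [AddCommGroup M]
    [Module C M] [Module K M] (D : Derivation K C M) (h : ∀ x : R, D (algebraMap R C x) = 0) :
    D = 0 := by
  ext a
  obtain ⟨⟨r, s⟩, hrs⟩ := IsLocalization.surj S a
  have h1 := congrArg D hrs
  rw [D.leibniz, h, h, smul_zero, zero_add] at h1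
  exact ((IsLocalization.map_units C s).smul_eq_zero).mp h1

/-- `Ω[C⁄K]` is the localization of `Ω[R⁄K]` at `S`, and `S` acts invertibly on the `C`-module `M`,
so the linear map of `D` on differentials extends. -/
theorem exists_extend_localization {K R C M : Type*} [CommRing K] [CommRing R] [CommRing C]
    [Algebra K R] [Algebra K C] [Algebra R C] [IsScalarTower K R C]
    (S : Submonoid R) [IsLocalization S C] [AddCommGroup M]
    [Module R M] [Module C M] [Module K M] [IsScalarTower R C M] [IsScalarTower K R M]
    [IsScalarTower K C M]
    (D : Derivation K R M) :
    ∃ D' : Derivation K C M, ∀ x, D' (algebraMap R C x) = D x := by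
  have hu : ∀ x : S, IsUnit (algebraMap R (Module.End R M) x) := fun x => by
    rw [Module.End.isUnit_iff]
    have hx := IsLocalization.map_units C x
    obtain ⟨u, hu⟩ := hx
    constructor
    · intro a b hab
      simp only [Module.algebraMap_end_apply] at hab
      rw [← algebraMap_smul C (x : R) a, ← algebraMap_smul C (x : R) b, ← hu] at hab
      exact smul_left_cancel u hab
    · intro a
      refine ⟨(↑u⁻¹ : C) • a, ?_⟩
      rw [Module.algebraMap_end_apply, ← algebraMap_smul C, ← hu, smul_smul]
      simp
  have : IsLocalizedModule S (KaehlerDifferential.map K K R C) := by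
    exact KaehlerDifferential.isLocalizedModule_map K R C S
  let l := IsLocalizedModule.lift S (KaehlerDifferential.map K K R C) D.liftKaehlerDifferential hu
  let l' : Ω[C⁄K] →ₗ[C] M := l.extendScalarsOfIsLocalization S C
  refine ⟨l'.compDer (KaehlerDifferential.D K C), fun x => ?_⟩
  have := IsLocalizedModule.lift_apply S (KaehlerDifferential.map K K R C)
    D.liftKaehlerDifferential hu (KaehlerDifferential.D K R x)
  simpa using! this

theorem exists_factor_of_surjective {K R C M : Type*} [CommRing K] [CommRing R] [CommRing C]
    [Algebra K R] [Algebra K C] [Algebra R C] [IsScalarTower K R C] [AddCommGroup M]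
    [Module R M] [Module C M] [Module K M] [IsScalarTower R C M]
    (hsurj : Function.Surjective (algebraMap R C)) (D : Derivation K R M)
    (hD : ∀ x, algebraMap R C x = 0 → D x = 0) :
    ∃ D' : Derivation K C M, ∀ x, D' (algebraMap R C x) = D x := by
  have key : ∀ x y, algebraMap R C x = algebraMap R C y → D x = D y := fun x y h => by
    rw [← sub_eq_zero, ← map_sub]
    exact hD _ (by rw [map_sub, h, sub_self])
  let g := Function.surjInv hsurj
  have hg : ∀ c, algebraMap R C (g c) = c := Function.surjInv_eq hsurj
  let L : C →ₗ[K] M :=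
    { toFun := fun c => D (g c)
      map_add' := fun a b => by
        rw [← map_add]
        exact key _ _ (by rw [map_add, hg, hg, hg])
      map_smul' := fun k a => by
        rw [RingHom.id_apply, ← map_smul]
        refine key _ _ ?_
        rw [hg, Algebra.smul_def, Algebra.smul_def, map_mul, hg,
          ← IsScalarTower.algebraMap_apply] }
  refine ⟨Derivation.mk' L fun a b => ?_, fun x => key _ _ (hg _)⟩
  change D (g (a * b)) = a • D (g b) + b • D (g a)
  nth_rewrite 2 [← hg a]
  nth_rewrite 3 [← hg b]
  rw [algebraMap_smul, algebraMap_smul, ← D.leibniz]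
  exact key _ _ (by rw [map_mul, hg, hg, hg])

end Derivation

theorem presHom_generator {K : Type*} [Field K] {n m : ℕ} (f : Fin m → MvPolynomial (Fin n) K)
    (A : Type*) [CommRing A]
    [Algebra (MvPolynomial (Fin n) K ⧸ Ideal.span (Set.range f)) A] (i : Fin m) :
    presHom f A (f i) = 0 := by
  rw [presHom, RingHom.comp_apply, Ideal.Quotient.eq_zero_iff_mem.mpr, map_zero]
  exact Ideal.subset_span ⟨i, rfl⟩

variable {K : Type*} [Field K] {n m : ℕ} (f : Fin m → MvPolynomial (Fin n) K)
variable (A : Type*) [CommRing A] [Algebra K A]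
variable [Algebra (MvPolynomial (Fin n) K ⧸ Ideal.span (Set.range f)) A]
variable [IsScalarTower K (MvPolynomial (Fin n) K ⧸ Ideal.span (Set.range f)) A]

theorem presHom_C (k : K) : presHom f A (MvPolynomial.C k) = algebraMap K A k := by
  rw [IsScalarTower.algebraMap_apply K (MvPolynomial (Fin n) K ⧸ Ideal.span (Set.range f)) A]
  rfl

variable {A}

theorem derivation_presHom {M : Type*} [AddCommGroup M] [Module A M] [Module K M]
    (D : Derivation K A M) (p : MvPolynomial (Fin n) K) :
    D (presHom f A p) =
      ∑ j, presHom f A (MvPolynomial.pderiv j p) • D (presHom f A (MvPolynomial.X j)) := by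
  induction p using MvPolynomial.induction_on with
  | C a => simp [presHom_C]
  | add p q hp hq => simp [hp, hq, add_smul, Finset.sum_add_distrib]
  | mul_X p i hp =>
    rw [map_mul, D.leibniz, hp, Finset.smul_sum]
    simp only [Derivation.leibniz, smul_eq_mul, map_add, map_mul, add_smul,
      Finset.sum_add_distrib, mul_smul, MvPolynomial.pderiv_X]
    congr 1
    rw [Finset.sum_eq_single i]
    · simp
    · intro b _ hb
      simp [hb.symm]
    · simp

theorem sum_jacobianMatrix_smul_derivation {M : Type*} [AddCommGroup M] [Module A M] [Module K M]
    (D : Derivation K A M) (i : Fin m) :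
    ∑ j, jacobianMatrix f A i j • D (presHom f A (MvPolynomial.X j)) = 0 := by
  have := derivation_presHom f D (f i)
  rw [presHom_generator, map_zero] at this
  exact this.symm

theorem jacobianMatrix_mulVec_derivation (D : Derivation K A A) :
    jacobianMatrix f A *ᵥ (fun j => D (presHom f A (MvPolynomial.X j))) = 0 :=
  funext fun i => sum_jacobianMatrix_smul_derivation f D i

theorem derivation_eq_zero_of_X
    (S : Submonoid (MvPolynomial (Fin n) K ⧸ Ideal.span (Set.range f))) [IsLocalization S A]
    {M : Type*} [AddCommGroup M] [Module A M] [Module K M] (D : Derivation K A M)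
    (h : ∀ j, D (presHom f A (MvPolynomial.X j)) = 0) : D = 0 := by
  refine D.eq_zero_of_algebraMap_eq_zero S fun x => ?_
  obtain ⟨p, rfl⟩ := Ideal.Quotient.mk_surjective x
  change D (presHom f A p) = 0
  simp [derivation_presHom f D p, h]

/-- The polynomial derivation `x_j ↦ v_j` kills the generators `f_i`, hence the whole ideal, which
acts as zero on `M`; it then descends and localizes. It is applied with `M = A` and with `M` a
residue field. -/
theorem exists_derivation
    (S : Submonoid (MvPolynomial (Fin n) K ⧸ Ideal.span (Set.range f))) [IsLocalization S A]
    {M : Type*} [AddCommGroup M] [Module A M] [Module K M] [IsScalarTower K A M] (v : Fin n → M)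
    (hv : ∀ i, ∑ j, jacobianMatrix f A i j • v j = 0) :
    ∃ D : Derivation K A M, ∀ j, D (presHom f A (MvPolynomial.X j)) = v j := by
  let R := MvPolynomial (Fin n) K ⧸ Ideal.span (Set.range f)
  let : Module R M := Module.compHom M (algebraMap R A)
  let : Module (MvPolynomial (Fin n) K) M := Module.compHom M (presHom f A)
  have h1 : IsScalarTower R A M := ⟨fun x y z => by
    rw [Algebra.smul_def, mul_smul]; rfl⟩
  have h2 : IsScalarTower (MvPolynomial (Fin n) K) R M := ⟨fun x y z => by
    change algebraMap R A (Ideal.Quotient.mk _ x * y) • z =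
      presHom f A x • (algebraMap R A y • z)
    rw [map_mul, mul_smul]; rfl⟩
  have h3 : IsScalarTower K R M := ⟨fun x y z => by
    change algebraMap R A (x • y) • z = x • (algebraMap R A y • z)
    rw [← smul_assoc]
    congr 1
    rw [Algebra.smul_def x y, map_mul, ← IsScalarTower.algebraMap_apply, Algebra.smul_def]⟩
  have h4 : IsScalarTower K (MvPolynomial (Fin n) K) M := ⟨fun x y z => by
    change presHom f A (x • y) • z = x • (presHom f A y • z)
    rw [← smul_assoc]
    congr 1
    rw [MvPolynomial.smul_eq_C_mul, map_mul, presHom_C, Algebra.smul_def]⟩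
  let D₀ : Derivation K (MvPolynomial (Fin n) K) M := MvPolynomial.mkDerivation K v
  have hD₀ : ∀ p, D₀ p = ∑ j, presHom f A (MvPolynomial.pderiv j p) • v j := by
    intro p
    induction p using MvPolynomial.induction_on with
    | C a => simp [D₀]
    | add p q hp hq => simp [hp, hq, add_smul, Finset.sum_add_distrib]
    | mul_X p i hp =>
      rw [D₀.leibniz, hp, Finset.smul_sum]
      simp only [Derivation.leibniz, smul_eq_mul, map_add, map_mul, add_smul,
        Finset.sum_add_distrib, mul_smul, MvPolynomial.pderiv_X]
      congr 1
      rw [Finset.sum_eq_single i]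
      · simp only [D₀, MvPolynomial.mkDerivation_X, Pi.single_eq_same, map_one, one_smul]
        rfl
      · intro b _ hb
        simp [hb.symm]
      · simp
  have hker : ∀ p, algebraMap (MvPolynomial (Fin n) K) R p = 0 → D₀ p = 0 := by
    intro p hp
    have hp' : p ∈ Ideal.span (Set.range f) := Ideal.Quotient.eq_zero_iff_mem.mp hp
    clear hp
    induction hp' using Submodule.span_induction with
    | mem x hx =>
      obtain ⟨i, rfl⟩ := hx
      rw [hD₀]
      exact hv i
    | zero => exact map_zero _
    | add x y _ _ hx hy => rw [map_add, hx, hy, add_zero]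
    | smul a x hx hx0 =>
      rw [smul_eq_mul, D₀.leibniz, hx0, smul_zero, zero_add]
      change presHom f A x • D₀ a = 0
      have : presHom f A x = 0 := by
        rw [presHom, RingHom.comp_apply, Ideal.Quotient.eq_zero_iff_mem.mpr hx, map_zero]
      rw [this, zero_smul]
  obtain ⟨D₁, hD₁⟩ := D₀.exists_factor_of_surjective (C := R) Ideal.Quotient.mk_surjective hker
  obtain ⟨D₂, hD₂⟩ := D₁.exists_extend_localization (C := A) S
  refine ⟨D₂, fun j => ?_⟩
  have : D₂ (presHom f A (MvPolynomial.X j)) = D₀ (MvPolynomial.X j) := by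
    rw [← hD₁, ← hD₂]; rfl
  rw [this]
  exact MvPolynomial.mkDerivation_X K v j

end DerivationLemmas

/-! ### Transcendence degree, chains of primes and derivations of fields -/

section TranscendenceDegree

open Matrix Module

theorem aeval_finCons_eq_eval₂ {K B : Type*} [CommRing K] [CommRing B] [Algebra K B] {s : ℕ}
    (y : B) (t : Fin s → B) (g : MvPolynomial (Fin (s + 1)) K) :
    MvPolynomial.aeval (Fin.cons y t : Fin (s + 1) → B) g =
      Polynomial.eval₂ (MvPolynomial.aeval t : MvPolynomial (Fin s) K →ₐ[K] B).toRingHom y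
        (MvPolynomial.finSuccEquiv K s g) := by
  induction g using MvPolynomial.induction_on with
  | C a => simp [MvPolynomial.finSuccEquiv_apply]
  | add p q hp hq => rw [map_add, map_add, Polynomial.eval₂_add, hp, hq]
  | mul_X p i hp =>
    rw [map_mul, map_mul, Polynomial.eval₂_mul, hp]
    congr 1
    refine Fin.cases ?_ (fun j => ?_) i
    · simp [MvPolynomial.finSuccEquiv_X_zero]
    · simp [MvPolynomial.finSuccEquiv_X_succ]

/-- A family that is algebraically independent modulo a prime `q` can be enlarged to one that is
algebraically independent modulo a strictly smaller prime `p`. -/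
theorem exists_indep_mod_of_lt {K B : Type*} [Field K] [CommRing B] [Algebra K B]
    {p q : Ideal B} [hp : p.IsPrime] (hpq : p < q) {s : ℕ} (t : Fin s → B)
    (ht : ∀ g : MvPolynomial (Fin s) K, MvPolynomial.aeval t g ∈ q → g = 0) :
    ∃ t' : Fin (s + 1) → B,
      ∀ g : MvPolynomial (Fin (s + 1)) K, MvPolynomial.aeval t' g ∈ p → g = 0 := by
  obtain ⟨y, hyq, hyp⟩ := Set.exists_of_ssubset hpq
  let φ := (MvPolynomial.aeval t : MvPolynomial (Fin s) K →ₐ[K] B).toRingHom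
  -- The new element `y` lies in `q` but not in `p`. Modulo `q` only the constant coefficient of a
  -- relation survives, so it is zero; then a factor `y ∉ p` cancels and the degree drops.
  have key : ∀ (N : ℕ) (G : Polynomial (MvPolynomial (Fin s) K)), G.natDegree ≤ N →
      Polynomial.eval₂ φ y G ∈ p → G = 0 := by
    intro N
    induction N with
    | zero =>
      intro G hG hGp
      rw [Polynomial.eq_C_of_natDegree_le_zero hG, Polynomial.eval₂_C] at hGp
      rw [Polynomial.eq_C_of_natDegree_le_zero hG, ht _ (hpq.le hGp), map_zero]
    | succ N ih =>
      intro G hG hGp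
      have h0 : G.coeff 0 = 0 := by
        refine ht _ ?_
        have h := hpq.le hGp
        rw [← G.divX_mul_X_add, Polynomial.eval₂_add, Polynomial.eval₂_mul, Polynomial.eval₂_X,
          Polynomial.eval₂_C] at h
        exact (Ideal.add_mem_iff_right _ (Ideal.mul_mem_left _ _ hyq)).mp h
      have hG' : G = G.divX * Polynomial.X := by
        conv_lhs => rw [← G.divX_mul_X_add, h0, map_zero, add_zero]
      rw [hG', Polynomial.eval₂_mul, Polynomial.eval₂_X] at hGp
      have := ih G.divX (by rw [Polynomial.natDegree_divX_eq_natDegree_tsub_one]; omega)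
        ((hp.mem_or_mem hGp).resolve_right hyp)
      rw [hG', this, zero_mul]
  refine ⟨Fin.cons y t, fun g hg => ?_⟩
  rw [aeval_finCons_eq_eval₂] at hg
  have := key _ _ le_rfl hg
  simpa using this

theorem exists_indep_of_ltSeries {K B : Type*} [Field K] [CommRing B] [IsDomain B] [Algebra K B]
    (l : LTSeries (PrimeSpectrum B)) {s : ℕ} (t : Fin s → B)
    (ht : ∀ g : MvPolynomial (Fin s) K, MvPolynomial.aeval t g ∈ l.last.asIdeal → g = 0) :
    ∃ t' : Fin (s + l.length) → B, AlgebraicIndependent K t' := by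
  -- Descent from the top prime of the chain, gaining one element at each strict inclusion.
  have key : ∀ k : ℕ, k ≤ l.length → ∃ t' : Fin (s + k) → B,
      ∀ g : MvPolynomial (Fin (s + k)) K, MvPolynomial.aeval t' g ∈
        (l ⟨l.length - k, by omega⟩).asIdeal → g = 0 := by
    intro k
    induction k with
    | zero => exact fun _ => ⟨t, ht⟩
    | succ k ih =>
      intro hk
      obtain ⟨t', ht'⟩ := ih (by omega)
      have hlt : l ⟨l.length - (k + 1), by omega⟩ < l ⟨l.length - k, by omega⟩ :=
        l.strictMono (by rw [Fin.lt_def]; dsimp only; omega)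
      exact exists_indep_mod_of_lt (p := (l ⟨l.length - (k + 1), by omega⟩).asIdeal)
        (hp := (l _).isPrime) hlt t' ht'
  obtain ⟨t', ht'⟩ := key l.length le_rfl
  refine ⟨t', (injective_iff_map_eq_zero _).mpr fun g hg => ht' g ?_⟩
  rw [hg]
  exact zero_mem _

/-- `D` is linear over `L = K(t)`, and `F` is algebraic over `L`, hence separable in characteristic
zero, so `Ω[F⁄L] = 0`. -/
theorem Derivation.eq_zero_of_isTranscendenceBasis {K F ι : Type*} [Field K] [CharZero K] [Field F]
    [Algebra K F] {t : ι → F} (ht : IsTranscendenceBasis K t) (D : Derivation K F F)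
    (hD : ∀ i, D (t i) = 0) : D = 0 := by
  let L := IntermediateField.adjoin K (Set.range t)
  have hL : ∀ x ∈ L, D x = 0 := by
    intro x hx
    induction hx using IntermediateField.adjoin_induction with
    | mem x hx => obtain ⟨i, rfl⟩ := hx; exact hD i
    | algebraMap x => exact D.map_algebraMap x
    | add x y _ _ hx hy => rw [map_add, hx, hy, add_zero]
    | inv x _ hx => rw [D.leibniz_inv, hx, smul_zero]
    | mul x y _ _ hx hy => rw [D.leibniz, hx, hy, smul_zero, smul_zero, add_zero]
  let DL : Derivation L F F := Derivation.mk'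
    { toFun := D
      map_add' := map_add D
      map_smul' := fun c x => by
        have hc : D (algebraMap L F c) = 0 := hL _ c.2
        rw [Algebra.smul_def, D.leibniz, hc, smul_zero, add_zero, algebraMap_smul]
        rfl } (fun a b => D.leibniz a b)
  have : Algebra.IsAlgebraic L F := ht.isAlgebraic_field
  have : CharZero F := charZero_of_injective_algebraMap (algebraMap K F).injective
  have : CharZero L := charZero_of_injective_algebraMap (algebraMap K L).injective
  have : Algebra.FormallyUnramified L F := Algebra.FormallyUnramified.of_isSeparable L F
  ext x
  have h : DL x = 0 := by
    rw [← DL.liftKaehlerDifferential_comp_D x,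
      Subsingleton.elim (KaehlerDifferential.D L F x) 0, map_zero]
  exact h

/-- By duality the hypothesis says `Ω[F⁄L] = 0` for `L = K(s)`; an unramified, essentially finite
type field extension is separable algebraic. -/
theorem isAlgebraic_of_forall_derivation_eq_zero {K F : Type*} [Field K] [CharZero K] [Field F]
    [Algebra K F] [Algebra.EssFiniteType K F] (s : Set F)
    (h : ∀ D : Derivation K F F, (∀ x ∈ s, D x = 0) → D = 0) :
    Algebra.IsAlgebraic (Algebra.adjoin K s) F := by
  let L := IntermediateField.adjoin K s
  have hsub : Subsingleton (Ω[F⁄L]) := by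
    have h0 : ∀ x, KaehlerDifferential.D L F x = 0 := by
      intro x
      rw [← Module.forall_dual_apply_eq_zero_iff F]
      intro φ
      have := h ((φ.compDer (KaehlerDifferential.D L F)).restrictScalars K) fun y hy => by
        have hy' : y ∈ L := IntermediateField.subset_adjoin K s hy
        exact (φ.compDer (KaehlerDifferential.D L F)).map_algebraMap ⟨y, hy'⟩
      exact congrArg (fun D : Derivation K F F => D x) this
    refine subsingleton_of_forall_eq 0 fun w => ?_
    have hw : w ∈ Submodule.span F (Set.range (KaehlerDifferential.D L F)) := by
      rw [KaehlerDifferential.span_range_derivation]; trivial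
    have hr : Set.range (KaehlerDifferential.D L F) ⊆ {0} := by
      rintro _ ⟨x, rfl⟩
      exact h0 x
    simpa using Submodule.span_mono hr hw
  have : Algebra.FormallyUnramified L F := ⟨hsub⟩
  have : Algebra.EssFiniteType L F := Algebra.EssFiniteType.of_comp K L F
  have : Algebra.IsSeparable L F := Algebra.FormallyUnramified.isSeparable L F
  have : Algebra.IsAlgebraic L F := inferInstance
  rwa [← IntermediateField.isAlgebraic_adjoin_iff_top]

end TranscendenceDegree

/-! ### The Jacobian criterion -/

section JacobianCriterion

open Matrix Module

variable {K : Type*} [Field K] [CharZero K] {n m : ℕ} (f : Fin m → MvPolynomial (Fin n) K)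
variable {A : Type*} [CommRing A] [IsDomain A] [Algebra K A]
variable [Algebra (MvPolynomial (Fin n) K ⧸ Ideal.span (Set.range f)) A]
variable [IsScalarTower K (MvPolynomial (Fin n) K ⧸ Ideal.span (Set.range f)) A]

/-- This says `trdeg Q ≤ n - r`. A derivation of `Q` that vanishes on the variables outside the
columns of a nonzero `r`-minor vanishes on the others too, by the square system of that minor; so
`Q` is algebraic over those `n - r` variables. -/
theorem card_add_jacobianRank_le
    (S : Submonoid (MvPolynomial (Fin n) K ⧸ Ideal.span (Set.range f))) [IsLocalization S A] {N : ℕ} (t : Fin N → FractionRing A)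
    (ht : AlgebraicIndependent K t) : N + jacobianRank f A ≤ n := by
  let F := FractionRing A
  let J := (jacobianMatrix f A).map (algebraMap A F)
  obtain ⟨i, j, hij⟩ := exists_det_submatrix_ne_zero J (s := jacobianRank f A) le_rfl
  let x : Fin n → F := fun l => algebraMap A F (presHom f A (MvPolynomial.X l))
  classical
  let T : Finset (Fin n) := (Finset.univ.map j.toEmbedding)ᶜ
  have hT : T.card + jacobianRank f A = n := by
    have := Finset.card_compl_add_card (Finset.univ.map j.toEmbedding)
    simpa [T] using this
  have : Algebra.EssFiniteType (MvPolynomial (Fin n) K ⧸ Ideal.span (Set.range f)) A :=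
    Algebra.EssFiniteType.of_isLocalization A S
  have : Algebra.EssFiniteType K A :=
    Algebra.EssFiniteType.comp K (MvPolynomial (Fin n) K ⧸ Ideal.span (Set.range f)) A
  have : Algebra.EssFiniteType A F := Algebra.EssFiniteType.of_isLocalization F (nonZeroDivisors A)
  have : Algebra.EssFiniteType K F := Algebra.EssFiniteType.comp K A F
  have halg : Algebra.IsAlgebraic (Algebra.adjoin K (T.image x : Set F)) F := by
    refine isAlgebraic_of_forall_derivation_eq_zero _ fun D hD => ?_
    refine D.eq_zero_of_algebraMap_eq_zero (nonZeroDivisors A) fun a => ?_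
    have hDT : ∀ l, l ∉ Set.range j → D (x l) = 0 := fun l hl => by
      refine hD _ (by
        simp only [Finset.coe_image]
        exact ⟨l, by simpa [T] using hl, rfl⟩)
    have hsum : J *ᵥ (fun l => D (x l)) = 0 := by
      ext k
      have := sum_jacobianMatrix_smul_derivation f (D.compAlgebraMap A) k
      simpa [Matrix.mulVec, dotProduct, J, Algebra.smul_def, x] using! this
    have hsub : J.submatrix i j *ᵥ (fun b => D (x (j b))) = 0 := by
      ext k
      have h := congrFun hsum (i k)
      simp only [Matrix.mulVec, dotProduct, Pi.zero_apply, submatrix_apply] at h ⊢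
      refine (Finset.sum_map Finset.univ j.toEmbedding
        (fun l => J (i k) l * D (x l))).symm.trans (Eq.trans ?_ h)
      refine Finset.sum_subset (Finset.subset_univ _) fun l _ hl => ?_
      rw [hDT l (by simpa using hl), mul_zero]
    have hz := Matrix.eq_zero_of_mulVec_eq_zero hij hsub
    have hall : ∀ l, D (x l) = 0 := fun l => by
      by_cases hl : l ∈ Set.range j
      · obtain ⟨b, rfl⟩ := hl
        exact congrFun hz b
      · exact hDT l hl
    have := derivation_eq_zero_of_X f S (D.compAlgebraMap A) hall
    exact congrArg (fun E : Derivation K A F => E a) this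
  have h1 := Algebra.IsAlgebraic.trdeg_le_cardinalMk K (T.image x : Set F)
  have h2 := ht.lift_cardinalMk_le_trdeg
  have h3 : N ≤ (T.image x).card := by
    have h1' : Algebra.trdeg K F ≤ ((T.image x).card : Cardinal) := by
      simpa using h1
    have := h2.trans (Cardinal.lift_le.mpr h1')
    simpa using this
  have h4 : (T.image x).card ≤ T.card := Finset.card_image_le
  omega

open IsLocalRing in
/-- A derivation of a local ring into its residue field is determined by its values on generators
of the maximal ideal and on lifts of a transcendence basis of the residue field. -/
theorem Derivation.eq_zero_of_residueField {B : Type*} [CommRing B] [IsLocalRing B] [Algebra K B]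
    {s : Set B} (hs : Ideal.span s = maximalIdeal B) {ι : Type*} {t : ι → B}
    (ht : IsTranscendenceBasis K (fun i => residue B (t i)))
    (D : Derivation K B (ResidueField B)) (hDs : ∀ x ∈ s, D x = 0) (hDt : ∀ i, D (t i) = 0) :
    D = 0 := by
  have hres : ∀ x ∈ maximalIdeal B, ∀ y : ResidueField B, x • y = 0 := fun x hx y => by
    rw [Algebra.smul_def, ResidueField.algebraMap_eq, (residue_eq_zero_iff x).mpr hx, zero_mul]
  have hker : ∀ x ∈ maximalIdeal B, D x = 0 := by
    intro x hx
    rw [← hs] at hx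
    induction hx using Submodule.span_induction with
    | mem x hx => exact hDs x hx
    | zero => exact map_zero _
    | add x y _ _ hx hy => rw [map_add, hx, hy, add_zero]
    | smul a x hx hx0 =>
      rw [smul_eq_mul, D.leibniz, hx0, smul_zero, zero_add]
      exact hres x (hs ▸ hx) _
  obtain ⟨D', hD'⟩ := D.exists_factor_of_surjective (C := ResidueField B) residue_surjective
    fun x hx => hker x ((residue_eq_zero_iff x).mp hx)
  have : D' = 0 := D'.eq_zero_of_isTranscendenceBasis ht fun i => by
    rw [← hDt i, ← hD' (t i)]; rfl
  ext x
  rw [← hD', this]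
  rfl

open IsLocalRing in
theorem finrank_derivation_residueField_le {B : Type*} [CommRing B] [IsLocalRing B] [Algebra K B]
    [IsNoetherianRing B] {ι : Type*} [Fintype ι] {t : ι → ResidueField B}
    (ht : IsTranscendenceBasis K t) :
    Module.Finite (ResidueField B) (Derivation K B (ResidueField B)) ∧
    finrank (ResidueField B) (Derivation K B (ResidueField B)) ≤
      (maximalIdeal B).spanFinrank + Fintype.card ι := by
  have hfg := (maximalIdeal B).fg_of_isNoetherianRing
  have : Fintype (maximalIdeal B).generators :=
    (Submodule.FG.finite_generators hfg).fintype
  choose u hu using fun i => residue_surjective (t i)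
  let Ψ : Derivation K B (ResidueField B) →ₗ[ResidueField B]
      ((maximalIdeal B).generators ⊕ ι → ResidueField B) :=
    { toFun := fun D => Sum.elim (fun y => D y) (fun i => D (u i))
      map_add' := fun D E => by ext (y | i) <;> rfl
      map_smul' := fun c D => by ext (y | i) <;> rfl }
  have hΨ : Function.Injective Ψ := by
    refine (injective_iff_map_eq_zero Ψ).mpr fun D hD => ?_
    refine Derivation.eq_zero_of_residueField (maximalIdeal B).span_generators (t := u)
      (by simpa [hu] using ht) D (fun x hx => congrFun hD (Sum.inl ⟨x, hx⟩))
      (fun i => congrFun hD (Sum.inr i))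
  refine ⟨Module.Finite.of_injective Ψ hΨ, (LinearMap.finrank_le_finrank_of_injective hΨ).trans ?_⟩
  rw [Module.finrank_fintype_fun_eq_card, Fintype.card_sum, ← Submodule.FG.generators_ncard hfg,
    ← Nat.card_coe_set_eq, Nat.card_eq_fintype_card]

open IsLocalRing in
theorem rank_jacobianMatrix_residueField
    (S : Submonoid (MvPolynomial (Fin n) K ⧸ Ideal.span (Set.range f))) [IsLocalization S A]
    (p : Ideal A) [p.IsPrime] [IsRegularLocalRing (Localization.AtPrime p)] :
    jacobianRank f A ≤ ((jacobianMatrix f A).map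
      (algebraMap A (ResidueField (Localization.AtPrime p)))).rank := by
  let B := Localization.AtPrime p
  let κ := ResidueField B
  let J := (jacobianMatrix f A).map (algebraMap A κ)
  have hdim := IsRegularLocalRing.spanFinrank_maximalIdeal (R := B)
  obtain ⟨l, hl⟩ := Order.le_krullDim_iff.mp hdim.le
  obtain ⟨ι, t, ht⟩ := exists_isTranscendenceBasis' K κ
  let F := FractionRing A
  have hunit : ∀ y : p.primeCompl, IsUnit (algebraMap A F y) := fun y => by
    refine isUnit_iff_ne_zero.mpr fun h => y.2 ?_
    rw [(IsFractionRing.injective A F) (h.trans (map_zero _).symm)]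
    exact zero_mem p
  let φ : B →ₐ[K] F := IsLocalization.liftAlgHom (M := p.primeCompl)
    (f := IsScalarTower.toAlgHom K A F) hunit
  have hφ : Function.Injective φ := by
    refine (injective_iff_map_eq_zero φ).mpr fun b hb => ?_
    obtain ⟨a, y, rfl⟩ := IsLocalization.exists_mk'_eq p.primeCompl b
    have h1 : φ (algebraMap A B a) = 0 := by
      rw [← IsLocalization.mk'_spec B a y, map_mul, hb, zero_mul]
    have h2 : φ (algebraMap A B a) = algebraMap A F a :=
      IsLocalization.lift_eq (M := p.primeCompl) (S := B) hunit a
    rw [(IsFractionRing.injective A F) ((h2.symm.trans h1).trans (map_zero _).symm),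
      IsLocalization.mk'_zero]
  -- The transcendence basis of `κ` is not yet known to be finite, so the bound is proved for its
  -- finite subsets; being uniform, it then gives finiteness.
  have hcard : ∀ T : Finset ι, T.card + (maximalIdeal B).spanFinrank + jacobianRank f A ≤ n := by
    intro T
    choose u hu using fun i : Fin T.card => residue_surjective (t (T.equivFin.symm i))
    have hind : AlgebraicIndependent K (fun i => residue B (u i)) := by
      simp only [hu]
      exact ht.1.comp _ (Subtype.val_injective.comp T.equivFin.symm.injective)
    obtain ⟨w, hw⟩ := exists_indep_of_ltSeries (K := K) l u fun g hg => by
      refine (injective_iff_map_eq_zero _).mp hind g ?_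
      have := (residue_eq_zero_iff _).mpr (le_maximalIdeal l.last.isPrime.ne_top hg)
      rw [← this]
      have h := MvPolynomial.map_aeval u (residue B) g
      rw [h, MvPolynomial.aeval_def, MvPolynomial.coe_eval₂Hom]
      rfl
    have := card_add_jacobianRank_le f S _ (hw.map' hφ)
    rwa [hl] at this
  have hfin : Finite ι := by
    by_contra h
    have : Infinite ι := not_finite_iff_infinite.mp h
    obtain ⟨T, hT⟩ := Infinite.exists_subset_card_eq ι (n + 1)
    have := hcard T
    omega
  cases nonempty_fintype ι
  have hι := hcard Finset.univ
  rw [Finset.card_univ] at hι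
  obtain ⟨hfd, hle⟩ := finrank_derivation_residueField_le ht
  let Φ : Derivation K B κ →ₗ[κ] (Fin n → κ) :=
    { toFun := fun D j => D (algebraMap A B (presHom f A (MvPolynomial.X j)))
      map_add' := fun D E => rfl
      map_smul' := fun c D => rfl }
  -- A kernel vector over `κ` defines a derivation `A → κ`, which extends to `A_p`.
  have hker : LinearMap.ker J.mulVecLin ≤ LinearMap.range Φ := by
    intro v hv
    obtain ⟨D, hD⟩ := exists_derivation (A := A) f S v fun i => by
      have := congrFun (LinearMap.mem_ker.mp hv) i
      simpa [Matrix.mulVec, dotProduct, J, Algebra.smul_def] using! this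
    obtain ⟨D', hD'⟩ := D.exists_extend_localization (C := B) p.primeCompl
    exact ⟨D', funext fun j => (hD' _).trans (hD j)⟩
  have h1 := finrank_ker_mulVecLin J
  have h2 : finrank κ (LinearMap.ker J.mulVecLin) ≤
      (maximalIdeal B).spanFinrank + Fintype.card ι :=
    ((Submodule.finrank_mono hker).trans (LinearMap.finrank_range_le Φ)).trans hle
  rw [Fintype.card_fin] at h1
  change _ ≤ J.rank
  omega

/-- The Jacobian criterion: on a regular ring, the minors of maximal rank of the Jacobian matrix
have no common zero. -/
theorem exists_jacobianMinor_notMem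
    (S : Submonoid (MvPolynomial (Fin n) K ⧸ Ideal.span (Set.range f))) [IsLocalization S A]
    [IsRegularRing A] (p : Ideal A) [p.IsPrime] :
    ∃ (i : Fin (jacobianRank f A) ↪o Fin m) (j : Fin (jacobianRank f A) ↪o Fin n),
      jacobianMinor f A i j ∉ p := by
  obtain ⟨i, j, hij⟩ :=
    exists_det_submatrix_ne_zero _ (rank_jacobianMatrix_residueField f S p)
  refine ⟨i, j, fun hmem => hij ?_⟩
  rw [submatrix_map, ← RingHom.mapMatrix_apply, ← RingHom.map_det]
  rw [IsScalarTower.algebraMap_apply A (Localization.AtPrime p)]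
  refine (IsLocalRing.residue_eq_zero_iff _).mpr ?_
  rw [← Localization.AtPrime.map_eq_maximalIdeal]
  exact Ideal.mem_map_of_mem _ hmem

end JacobianCriterion

/-! ### Hamiltonian derivations and minors of the Poisson matrix -/

section PoissonLemmas

open Matrix Module

theorem det_submatrix_map_algebraMap {A ι κ : Type*} [CommRing A] {s : ℕ} (M : Matrix ι κ A) (i : Fin s → ι)
    (j : Fin s → κ) : ((M.map (algebraMap A (FractionRing A))).submatrix i j).det =
      algebraMap A (FractionRing A) (M.submatrix i j).det := by
  rw [submatrix_map, ← RingHom.mapMatrix_apply, ← RingHom.map_det]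

theorem le_fracRank_of_minorsIdeal_eq_top {A ι κ : Type*} [CommRing A] [IsDomain A] [Fintype ι] [Fintype κ] [LinearOrder ι]
    [LinearOrder κ] (M : Matrix ι κ A) {s : ℕ} (h : minorsIdeal M s = ⊤) : s ≤ fracRank M := by
  by_contra hlt
  have hz : minorsIdeal M s = ⊥ := by
    refine (Ideal.span_eq_bot).mpr ?_
    rintro _ ⟨i, j, rfl⟩
    by_contra hne
    refine hlt (le_rank_of_det_submatrix_ne_zero _ i j ?_)
    rw [det_submatrix_map_algebraMap]
    exact fun h0 => hne (IsFractionRing.injective A (FractionRing A) (h0.trans (map_zero _).symm))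
  exact bot_ne_top (hz.symm.trans h)

namespace PoissonBracket

theorem bracket_swap {K A : Type*} [CommRing K] [CommRing A] [Algebra K A]
    (π : PoissonBracket K A) (a b : A) : π.bracket a b = -π.bracket b a := by
  have h := π.bracket_self (a + b)
  simp only [map_add, LinearMap.add_apply, π.bracket_self, zero_add, add_zero] at h
  exact eq_neg_of_add_eq_zero_left (by rw [add_comm]; exact h)

theorem pad_apply {K A : Type*} [CommRing K] [CommRing A] [Algebra K A]
    (π : PoissonBracket K A) (a b : A) : π.pad a b = π.bracket a b := rfl

/-- The derivation `a ↦ {a, ·}` with values in the module of derivations. -/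
def padDerivation {K A : Type*} [CommRing K] [CommRing A] [Algebra K A]
    (π : PoissonBracket K A) : Derivation K A (Derivation K A A) :=
  Derivation.mk'
    { toFun := π.pad
      map_add' := fun a b => by ext c; simp [pad_apply]
      map_smul' := fun k a => by ext c; simp [pad_apply] }
    fun a b => by
      ext c
      change π.bracket (a * b) c = a * π.bracket b c + b * π.bracket a c
      rw [π.bracket_swap, π.leibniz, π.bracket_swap b, π.bracket_swap a]
      ring

end PoissonBracket

variable {K : Type*} [Field K] {n m : ℕ} (f : Fin m → MvPolynomial (Fin n) K)
variable {A : Type*} [CommRing A] [Algebra K A]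
variable [Algebra (MvPolynomial (Fin n) K ⧸ Ideal.span (Set.range f)) A]

theorem pad_X_X (π : PoissonBracket K A) (i j : Fin n) :
    π.pad (presHom f A (MvPolynomial.X i)) (presHom f A (MvPolynomial.X j)) =
      poissonMatrix f π i j := rfl

variable [IsScalarTower K (MvPolynomial (Fin n) K ⧸ Ideal.span (Set.range f)) A]

/-- Modulo the span of the `{x_i, ·}`, the map `a ↦ {a, ·}` is a derivation that kills every
variable, hence zero. -/
theorem hamiltonianSpan_eq_span_X
    (S : Submonoid (MvPolynomial (Fin n) K ⧸ Ideal.span (Set.range f))) [IsLocalization S A]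
    (π : PoissonBracket K A) :
    π.hamiltonianSpan =
      Submodule.span A (Set.range fun i => π.pad (presHom f A (MvPolynomial.X i))) := by
  refine le_antisymm (Submodule.span_le.mpr ?_) (Submodule.span_mono ?_)
  · rintro _ ⟨a, rfl⟩
    set N := Submodule.span A (Set.range fun i => π.pad (presHom f A (MvPolynomial.X i)))
    have h := derivation_eq_zero_of_X f S (N.mkQ.compDer π.padDerivation) fun j =>
      (Submodule.Quotient.mk_eq_zero N).mpr (Submodule.subset_span ⟨j, rfl⟩)
    exact (Submodule.Quotient.mk_eq_zero N).mp (congrArg (fun D => D a) h)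
  · rintro _ ⟨i, rfl⟩
    exact ⟨_, rfl⟩

theorem poissonMatrix_mul_jacobianMatrix_transpose (π : PoissonBracket K A) :
    poissonMatrix f π * (jacobianMatrix f A)ᵀ = 0 := by
  ext i k
  have := sum_jacobianMatrix_smul_derivation f (π.pad (presHom f A (MvPolynomial.X i))) k
  simp only [pad_X_X, smul_eq_mul] at this
  simpa [Matrix.mul_apply, mul_comm] using this

theorem poissonMatrix_map_mul_jacobianMatrix_map_transpose (π : PoissonBracket K A) :
    (poissonMatrix f π).map (algebraMap A (FractionRing A)) *
      ((jacobianMatrix f A).map (algebraMap A (FractionRing A)))ᵀ = 0 := by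
  rw [← Matrix.transpose_map, ← Matrix.map_mul, poissonMatrix_mul_jacobianMatrix_transpose]
  simp

variable [IsDomain A]

theorem fracRank_poissonMatrix_add_jacobianRank_le (π : PoissonBracket K A) :
    fracRank (poissonMatrix f π) + jacobianRank f A ≤ n := by
  have := rank_add_rank_le_card_of_mul_eq_zero
    (poissonMatrix_map_mul_jacobianMatrix_map_transpose f π)
  rw [rank_transpose, Fintype.card_fin] at this
  exact this

/-- Cramer's rule: for `i` a tuple of rows of maximal rank of the Jacobian matrix and every index
`l` outside the tuple `j`, there is a derivation with `x_l ↦ Δ(i, j)` that kills the other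
variables outside `j`. -/
theorem exists_derivation_of_nonsingularRows
    (S : Submonoid (MvPolynomial (Fin n) K ⧸ Ideal.span (Set.range f))) [IsLocalization S A]
    {i : Fin (jacobianRank f A) ↪o Fin m} (hi : i ∈ nonsingularRows f A)
    (j : Fin (jacobianRank f A) ↪o Fin n) (l : Fin n) :
    ∃ D : Derivation K A A, ∀ l' ∉ Set.range j,
      D (presHom f A (MvPolynomial.X l')) = if l' = l then jacobianMinor f A i j else 0 := by
  set J := jacobianMatrix f A with hJ
  let N := J.submatrix i j
  let c : Fin (jacobianRank f A) → A := N.adjugate *ᵥ fun k => J (i k) l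
  -- Since `N c = det N ·` (column `l` of the rows `i`), the rows `i` of `J` kill `v`; they span the
  -- row space over `Q`, so all of `J` kills it.
  let v : Fin n → A := Pi.single l N.det - ∑ k, Pi.single (j k) (c k)
  have hv1 : J.submatrix i id *ᵥ v = 0 := by
    have h : J.submatrix i id *ᵥ (∑ k, Pi.single (j k) (c k)) = N *ᵥ c := by
      ext a
      simp only [Matrix.mulVec, dotProduct, N, Finset.sum_apply, submatrix_apply, id_eq,
        Finset.mul_sum]
      rw [Finset.sum_comm]
      simp [Pi.single_apply]
    rw [Matrix.mulVec_sub, h]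
    simp only [c]
    rw [Matrix.mulVec_mulVec, Matrix.mul_adjugate, Matrix.smul_mulVec, Matrix.one_mulVec]
    ext a
    simp [Matrix.mulVec_single, mul_comm]
  have hv : J *ᵥ v = 0 := by
    obtain ⟨j', hj'⟩ := hi
    let F := FractionRing A
    have hrank : (J.map (algebraMap A F)).rank ≤
        ((J.map (algebraMap A F)).submatrix i id).rank := by
      refine le_rank_of_det_submatrix_ne_zero (s := jacobianRank f A) _ id j' ?_
      rw [submatrix_submatrix]
      change ((J.map (algebraMap A F)).submatrix i j').det ≠ 0
      rw [det_submatrix_map_algebraMap]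
      exact fun h0 => hj' (IsFractionRing.injective A F (h0.trans (map_zero _).symm))
    have h0 : (J.map (algebraMap A F)).submatrix i id *ᵥ (algebraMap A F ∘ v) = 0 := by
      ext a
      have := congrArg (algebraMap A F) (congrFun hv1 a)
      simpa [Matrix.mulVec, dotProduct] using this
    have h1 := mulVec_eq_zero_of_submatrix_mulVec_eq_zero _ i hrank h0
    ext a
    refine IsFractionRing.injective A F ?_
    have := congrFun h1 a
    simpa [Matrix.mulVec, dotProduct] using this
  obtain ⟨D, hD⟩ := exists_derivation (A := A) f S v fun a => congrFun hv a
  refine ⟨D, fun l' hl' => ?_⟩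
  rw [hD]
  have : ∀ k, j k ≠ l' := fun k hk => hl' ⟨k, hk⟩
  simp [v, Pi.single_apply, Finset.sum_apply, fun k => (this k).symm, jacobianMinor, N, hJ]

theorem jacobianMinor_pow_mem_of_hamiltonianSpan_eq_top
    (S : Submonoid (MvPolynomial (Fin n) K ⧸ Ideal.span (Set.range f))) [IsLocalization S A]
    (π : PoissonBracket K A) (h : π.hamiltonianSpan = ⊤)
    {i : Fin (jacobianRank f A) ↪o Fin m} (hi : i ∈ nonsingularRows f A)
    (j : Fin (jacobianRank f A) ↪o Fin n) :
    jacobianMinor f A i j ^ (n - jacobianRank f A) ∈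
      minorsIdeal (poissonMatrixDel f π j) (n - jacobianRank f A) := by
  classical
  have hcard : Fintype.card {l : Fin n // l ∉ Set.range j} = n - jacobianRank f A := by
    rw [Fintype.card_subtype_compl, Fintype.card_fin]
    congr 1
    exact (Set.card_range_of_injective j.injective).trans (Fintype.card_fin _)
  let e : Fin (n - jacobianRank f A) ≃ {l : Fin n // l ∉ Set.range j} :=
    (Fintype.equivFinOfCardEq hcard).symm
  have hB : ∀ a : Fin (n - jacobianRank f A), ∃ b : Fin n → A, ∀ l' ∉ Set.range j,
      ∑ k, b k * poissonMatrix f π k l' = if l' = e a then jacobianMinor f A i j else 0 := by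
    intro a
    obtain ⟨D, hD⟩ := exists_derivation_of_nonsingularRows f S hi j (e a)
    have hmem : D ∈ π.hamiltonianSpan := h ▸ Submodule.mem_top
    rw [hamiltonianSpan_eq_span_X f S, Submodule.mem_span_range_iff_exists_fun] at hmem
    obtain ⟨b, hb⟩ := hmem
    refine ⟨b, fun l' hl' => ?_⟩
    rw [← hD l' hl', ← hb, ← Derivation.coeFnAddMonoidHom_apply, map_sum, Finset.sum_apply]
    rfl
  choose B hB using hB
  -- Row `a` of `B` holds the Hamiltonian coefficients of the Cramer derivation for the `a`-th
  -- variable outside `j`.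
  have hprod : Matrix.of B * (poissonMatrixDel f π j).submatrix id e =
      jacobianMinor f A i j • (1 : Matrix (Fin (n - jacobianRank f A)) _ A) := by
    ext a a'
    rw [Matrix.mul_apply]
    refine (hB a (e a') (e a').2).trans ?_
    rw [Matrix.smul_apply, Matrix.one_apply, smul_eq_mul, mul_ite, mul_one, mul_zero]
    refine if_congr ?_ rfl rfl
    rw [Subtype.coe_inj, e.apply_eq_iff_eq, eq_comm]
  have := det_mul_mem_minorsIdeal (poissonMatrixDel f π j) (Matrix.of B) e
  rwa [hprod, Matrix.det_smul, Matrix.det_one, mul_one, Fintype.card_fin] at this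

theorem hamiltonianSpan_eq_top_of_minorsIdeal_eq_top
    (S : Submonoid (MvPolynomial (Fin n) K ⧸ Ideal.span (Set.range f))) [IsLocalization S A]
    (π : PoissonBracket K A) (hd : fracRank (poissonMatrix f π) = n - jacobianRank f A)
    (hc : minorsIdeal (poissonMatrix f π) (fracRank (poissonMatrix f π)) = ⊤) :
    π.hamiltonianSpan = ⊤ := by
  refine eq_top_iff.mpr fun D _ => ?_
  set C := poissonMatrix f π
  let x : Fin n → A := fun l => presHom f A (MvPolynomial.X l)
  let F := FractionRing A
  have hle := fracRank_poissonMatrix_add_jacobianRank_le f π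
  have hsum : fracRank C + ((jacobianMatrix f A).map (algebraMap A F)).rank =
      Fintype.card (Fin n) := by
    change fracRank C + jacobianRank f A = _
    rw [Fintype.card_fin]
    have : jacobianRank f A ≤ n := le_of_add_le_right hle
    omega
  -- Each `d`-minor carries `D` into the Hamiltonian span.
  have key : minorsIdeal C (fracRank C) ≤
      π.hamiltonianSpan.colon {D} := by
    refine Ideal.span_le.mpr ?_
    rintro _ ⟨i, j, rfl⟩
    rw [SetLike.mem_coe, Submodule.mem_colon_singleton]
    set N := C.submatrix i j with hN
    by_cases hdet : N.det = 0
    · rw [hdet, zero_smul]; exact zero_mem _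
    let c := (fun k => D (x (j k))) ᵥ* N.adjugate
    -- The Cramer coefficients `c` make `E` vanish on the `x_(j k)`; its vector lies in `ker J`, so
    -- `E = 0`.
    let E : Derivation K A A := N.det • D - ∑ k, c k • π.pad (x (i k))
    have hE : ∀ l, E (x l) = N.det * D (x l) - ∑ k, c k * C (i k) l := fun l => by
      simp only [E, Derivation.sub_apply, Derivation.smul_apply, smul_eq_mul]
      rw [← Derivation.coeFnAddMonoidHom_apply (∑ k, c k • π.pad (x (i k))), map_sum,
        Finset.sum_apply]
      rfl
    have hEj : ∀ k, E (x (j k)) = 0 := fun k => by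
      have h1 : c ᵥ* N = N.det • fun k => D (x (j k)) := by
        simp only [c]
        rw [Matrix.vecMul_vecMul, Matrix.adjugate_mul, Matrix.vecMul_smul, Matrix.vecMul_one]
      have h2 : ∑ a, c a * C (i a) (j k) = N.det * D (x (j k)) := congrFun h1 k
      rw [hE, h2, sub_self]
    have hE0 : E = 0 := by
      refine derivation_eq_zero_of_X f S E fun l => ?_
      have hzero := eq_zero_of_mem_ker_of_comp_eq_zero (C.map (algebraMap A F)) _
        (poissonMatrix_map_mul_jacobianMatrix_map_transpose f π) hsum i j
        (by
          rw [det_submatrix_map_algebraMap]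
          exact fun h0 => hdet (IsFractionRing.injective A F (h0.trans (map_zero _).symm)))
        (u := fun l => algebraMap A F (E (x l)))
        (by
          ext a
          have := congrArg (algebraMap A F) (congrFun (jacobianMatrix_mulVec_derivation f E) a)
          simpa [Matrix.mulVec, dotProduct, x] using! this)
        (by
          ext k
          simp [hEj])
      exact IsFractionRing.injective A F ((congrFun hzero l).trans (map_zero _).symm)
    rw [sub_eq_zero.mp hE0]
    exact sum_mem fun k _ => Submodule.smul_mem _ _ (Submodule.subset_span ⟨_, rfl⟩)
  rw [hc] at key
  have h1 := Submodule.mem_colon_singleton.mp (key (Submodule.mem_top (x := (1 : A))))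
  rwa [one_smul] at h1

theorem minorsIdeal_poissonMatrix_eq_top [CharZero K] [IsRegularRing A]
    (S : Submonoid (MvPolynomial (Fin n) K ⧸ Ideal.span (Set.range f))) [IsLocalization S A]
    (π : PoissonBracket K A)
    (h : ∀ i ∈ nonsingularRows f A, ∀ j ∈ nonsingularCols f A,
        ∃ k : ℕ, 1 ≤ k ∧ jacobianMinor f A i j ^ k ∈
          minorsIdeal (poissonMatrix f π) (n - jacobianRank f A)) :
    minorsIdeal (poissonMatrix f π) (n - jacobianRank f A) = ⊤ := by
  by_contra hne
  obtain ⟨p, hp, hle⟩ := Ideal.exists_le_maximal _ hne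
  obtain ⟨i, j, hij⟩ := exists_jacobianMinor_notMem f S p
  have h0 : jacobianMinor f A i j ≠ 0 := fun h0 => hij (h0 ▸ zero_mem p)
  obtain ⟨k, -, hk⟩ := h i ⟨j, h0⟩ j ⟨i, h0⟩
  exact hij (hp.isPrime.mem_of_pow_mem k (hle hk))

end PoissonLemmas

theorem theorem1p8 {K : Type*} [Field K] [CharZero K] {n m : ℕ}
    (f : Fin m → MvPolynomial (Fin n) K)
    (hI : (Ideal.span (Set.range f)).IsPrime)
    (S : Submonoid (MvPolynomial (Fin n) K ⧸ Ideal.span (Set.range f)))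
    {A : Type*} [CommRing A] [IsDomain A] [Algebra K A]
    [Algebra (MvPolynomial (Fin n) K ⧸ Ideal.span (Set.range f)) A]
    [IsScalarTower K (MvPolynomial (Fin n) K ⧸ Ideal.span (Set.range f)) A]
    [IsLocalization S A] [IsRegularRing A]
    (π : PoissonBracket K A) :
    List.TFAE [
      π.hamiltonianSpan = ⊤,
      fracRank (poissonMatrix f π) = n - jacobianRank f A ∧
        minorsIdeal (poissonMatrix f π) (fracRank (poissonMatrix f π)) = ⊤,
      ∀ i ∈ nonsingularRows f A, ∀ j ∈ nonsingularCols f A,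
        jacobianMinor f A i j ^ (n - jacobianRank f A) ∈
          minorsIdeal (poissonMatrixDel f π j) (n - jacobianRank f A),
      ∀ i ∈ nonsingularRows f A, ∀ j ∈ nonsingularCols f A,
        ∃ k : ℕ, 1 ≤ k ∧ jacobianMinor f A i j ^ k ∈
          minorsIdeal (poissonMatrix f π) (n - jacobianRank f A)] := by
  tfae_have 1 → 3 := fun h i hi j _ =>
    jacobianMinor_pow_mem_of_hamiltonianSpan_eq_top f S π h hi j
  tfae_have 3 → 4 := fun h i hi j hj => by
    -- The extra factor keeps the exponent positive when `n = r`.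
    refine ⟨n - jacobianRank f A + 1, Nat.le_add_left _ _, ?_⟩
    rw [pow_succ]
    exact Ideal.mul_mem_right _ _ (minorsIdeal_submatrix_le _ _ _ (h i hi j hj))
  tfae_have 4 → 2 := fun h => by
    have hc := minorsIdeal_poissonMatrix_eq_top f S π h
    have h1 := le_fracRank_of_minorsIdeal_eq_top _ hc
    have h2 := fracRank_poissonMatrix_add_jacobianRank_le f π
    have hd : fracRank (poissonMatrix f π) = n - jacobianRank f A := by omega
    exact ⟨hd, hd ▸ hc⟩
  tfae_have 2 → 1 := fun h => hamiltonianSpan_eq_top_of_minorsIdeal_eq_top f S π h.1 h.2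
  tfae_finish
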